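/- Let $V$ be a finite-dimensional vector space over a (commutative) field $F$ of arbitrary characteristic, let $Q\colon V\to F$ be a quadratic form (possibly zero) with polar form $B(x,y)=Q(x+y)-Q(x)-Q(y)$, and let $V^\perp=\{x\in V\mid B(x,y)=0 \text{ for all } y\in V\}$ be its radical. Let $O'(V,Q)$ be the group of all linear isometries of $(V,Q)$ onto itself that fix $V^\perp$ elementwise, $I'(V,Q)=O'(V,Q)\cap\{\mathrm{id}_V,-\mathrm{id}_V\}$ and $PO'(V,Q)=O'(V,Q)/I'(V,Q)$. Let $\mathrm{Cl}(V,Q)$ be the Clifford algebra, with even part $\mathrm{Cl}_0$, odd part $\mathrm{Cl}_1$ and main involution $\sigma$ (the algebra endomorphism with $\sigma(x)=-x$ for $x\in V$). Let $\mathrm{Lip}(V,Q)$ be the multiplicative submonoid of $\mathrm{Cl}(V,Q)$ generated by $F$, $V$ and all elements $1+st$ with $s,t\in V$ and $Q(s)=Q(t)=B(s,t)=0$, and let $\mathrm{Lip}^\times(V,Q)$ be the group of its invertible elements. For $p\in\mathrm{Lip}^\times(V,Q)$ let $\xi_p\in O'(V,Q)$ be the isometry $x\mapsto p\,x\,\sigma(p)^{-1}$.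 Let $\mathcal G(V,Q)=\{Fp\mid p\in\mathrm{Lip}^\times(V,Q)\}$, a group of points (one-dimensional subspaces of $\mathrm{Cl}(V,Q)$) under $(Fp)(Fq)=F(pq)$, let $\mathcal G_i(V,Q)$, $i\in\{0,1\}$, be the set of those points of $\mathcal G(V,Q)$ that are contained in $\mathrm{Cl}_i(V,Q)$, and let $\theta\colon\mathcal G(V,Q)\to PO'(V,Q)$ be the homomorphism that sends $Fp$ to the coset of $\xi_p$. Theorem 5.3. Suppose that $\dim V^\perp\ge 2$. Then $\theta$ is a surjective homomorphism of groups with the following properties. (a) If $Q(V^\perp)=\{0\}$, then $\ker\theta$ contains at least $|F|$ points from $\mathcal G_0(V,Q)$ but no points from $\mathcal G_1(V,Q)$. (b) If $Q(V^\perp)=\{0\}$ and $\dim V=\dim V^\perp$, then $\mathcal G_0(V,Q)=\mathcal G(V,Q)$. (c) If $Q(V^\perp)=\{0\}$ and $\dim V>\dim V^\perp$, then $\theta(\mathcal G_0(V,Q))\ne PO'(V,Q)$. (d) If $Q(V^\perp)\ne\{0\}$, then $\ker\theta$ contains at least $|F|$ points from $\mathcal G_0(V,Q)$ and at least $|F|$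 points from $\mathcal G_1(V,Q)$. Furthermore, $\theta(\mathcal G_0(V,Q))=PO'(V,Q)$. -/

import Mathlib

universe u v

namespace ProjMetric

open CliffordAlgebra

noncomputable section

variable {F : Type u} {V : Type v} [Field F] [AddCommGroup V] [Module F V]

/-! ### Metric vector spaces -/

/-- The radical `V^⊥` of the polar form `B(x, y) = Q(x + y) - Q(x) - Q(y)`. (It need not be totally
singular when `F` has characteristic two.) -/
def rad (Q : QuadraticForm F V) : Submodule F V := LinearMap.ker Q.polarBilin

theorem mem_rad {Q : QuadraticForm F V} {x : V} :
    x ∈ rad Q ↔ ∀ y, QuadraticMap.polar Q x y = 0 := by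
  simp [rad, LinearMap.mem_ker, LinearMap.ext_iff]

/-- The weak orthogonal group `O'(V, Q)`: all isometries of `(V, Q)` onto itself that fix the
radical elementwise. -/
def weakOrth (Q : QuadraticForm F V) : Subgroup (V ≃ₗ[F] V) where
  carrier := {φ | (∀ x, Q (φ x) = Q x) ∧ ∀ x ∈ rad Q, φ x = x}
  one_mem' := ⟨fun _ => rfl, fun _ _ => rfl⟩
  mul_mem' := by
    rintro a b ⟨ha, ha'⟩ ⟨hb, hb'⟩
    refine ⟨fun x => ?_, fun x hx => ?_⟩
    · rw [LinearEquiv.mul_apply, ha, hb]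
    · rw [LinearEquiv.mul_apply, hb' x hx, ha' x hx]
  inv_mem' := by
    rintro a ⟨ha, ha'⟩
    refine ⟨fun x => ?_, fun x hx => ?_⟩
    · rw [← ha (a⁻¹ x), ← LinearEquiv.mul_apply, mul_inv_cancel, LinearEquiv.coe_one, id_eq]
    · conv_lhs => rw [← ha' x hx]
      rw [← LinearEquiv.mul_apply, inv_mul_cancel, LinearEquiv.coe_one, id_eq]

/-- `I'(V, Q) = O'(V, Q) ∩ {id, -id}`, the kernel of the action of `O'(V, Q)` on the projective
space on `V`, as a subgroup of `O'(V, Q)`. -/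
def weakScalars (Q : QuadraticForm F V) : Subgroup (weakOrth Q) where
  carrier := {φ | φ.1 = LinearEquiv.refl F V ∨ φ.1 = LinearEquiv.neg F}
  one_mem' := Or.inl rfl
  mul_mem' := by
    rintro ⟨a, _⟩ ⟨b, _⟩ (ha | ha) (hb | hb) <;> dsimp only at ha hb <;> subst ha <;> subst hb
    · exact Or.inl rfl
    · exact Or.inr rfl
    · exact Or.inr rfl
    · exact Or.inl (LinearEquiv.ext fun x => by simp [LinearEquiv.mul_apply])
  inv_mem' := by
    rintro ⟨a, _⟩ (ha | ha) <;> dsimp only at ha <;> subst ha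
    · exact Or.inl rfl
    · exact Or.inr rfl

instance weakScalars_normal (Q : QuadraticForm F V) : (weakScalars Q).Normal where
  conj_mem := by
    rintro ⟨a, _⟩ ha ⟨g, _⟩
    rcases ha with ha | ha <;> dsimp only at ha <;> subst ha
    · refine Or.inl (LinearEquiv.ext fun x => ?_)
      change g ((g⁻¹ : V ≃ₗ[F] V) x) = x
      rw [← LinearEquiv.mul_apply, mul_inv_cancel, LinearEquiv.coe_one, id_eq]
    · refine Or.inr (LinearEquiv.ext fun x => ?_)
      change g (-((g⁻¹ : V ≃ₗ[F] V) x)) = -x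
      rw [map_neg, ← LinearEquiv.mul_apply, mul_inv_cancel, LinearEquiv.coe_one, id_eq]

/-- The projective weak orthogonal group `PO'(V, Q) = O'(V, Q) / I'(V, Q)`. -/
abbrev projWeakOrth (Q : QuadraticForm F V) : Type v := weakOrth Q ⧸ weakScalars Q

/-! ### Lipschitz groups -/

/-- The Lipschitz monoid `Lip(V, Q)`: the multiplicative submonoid of the Clifford algebra that is
generated by `F`, `V` and all `1 + s t` with `Q(s) = Q(t) = B(s, t) = 0`. -/
def lipMonoid (Q : QuadraticForm F V) : Submonoid (CliffordAlgebra Q) :=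
  Submonoid.closure
    (Set.range (algebraMap F (CliffordAlgebra Q)) ∪ Set.range (ι Q) ∪
      {m | ∃ s t : V, Q s = 0 ∧ Q t = 0 ∧ QuadraticMap.polar Q s t = 0 ∧ m = 1 + ι Q s * ι Q t})

/-- Linear isomorphism with the Clifford algebra of the zero form, in any characteristic. -/
theorem exists_equiv_zero (Q : QuadraticForm F V) :
    ∃ e : CliffordAlgebra Q ≃ₗ[F] CliffordAlgebra (0 : QuadraticForm F V),
      e 1 = 1 ∧ ∀ x, e (ι Q x) = ι 0 x := by
  obtain ⟨B, hB⟩ := LinearMap.BilinMap.toQuadraticMap_surjective (0 - Q)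
  exact ⟨changeFormEquiv hB, changeForm_one hB, changeForm_ι hB⟩

theorem ι_inj (Q : QuadraticForm F V) : Function.Injective (ι Q) := by
  obtain ⟨e, -, he⟩ := exists_equiv_zero Q
  intro x y h
  have h' := congrArg e h
  rw [he, he] at h'
  exact (ExteriorAlgebra.ι_leftInverse (R := F) (M := V)).injective h'

instance nontrivial_clifford (Q : QuadraticForm F V) : Nontrivial (CliffordAlgebra Q) := by
  obtain ⟨e, -, -⟩ := exists_equiv_zero Q
  have : Nontrivial (CliffordAlgebra (0 : QuadraticForm F V)) :=
    inferInstanceAs (Nontrivial (ExteriorAlgebra F V))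
  exact e.symm.injective.nontrivial

theorem ι_mul_rev (Q : QuadraticForm F V) (s t : V) (h : QuadraticMap.polar Q s t = 0) :
    ι Q t * ι Q s = -(ι Q s * ι Q t) := by
  have := ι_mul_ι_add_swap (Q := Q) s t
  rw [h, map_zero] at this
  exact eq_neg_of_add_eq_zero_right this

theorem ι_quad (Q : QuadraticForm F V) (s t : V) (hs : Q s = 0)
    (h : QuadraticMap.polar Q s t = 0) : ι Q s * ι Q t * (ι Q s * ι Q t) = 0 := by
  rw [mul_assoc, ← mul_assoc (ι Q t), ι_mul_rev Q s t h, neg_mul, mul_neg, ← mul_assoc,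
    ← mul_assoc, ι_sq_scalar, hs]
  simp

theorem lip_props {Q : QuadraticForm F V} {m : CliffordAlgebra Q} (hm : m ∈ lipMonoid Q) :
    reverse m ∈ lipMonoid Q ∧
    (∃ c : F, m * reverse m = algebraMap F _ c ∧ reverse m * m = algebraMap F _ c) ∧
    ∀ x, ∃ y, m * ι Q x * involute (reverse m) = ι Q y := by
  induction hm using Submonoid.closure_induction with
  | mem m hm =>
    rcases hm with (⟨c, rfl⟩ | ⟨a, rfl⟩) | ⟨s, t, hs, ht, hst, rfl⟩
    · refine ⟨?_, ⟨c * c, ?_, ?_⟩, fun x => ⟨c • c • x, ?_⟩⟩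
      · rw [reverse.commutes]
        exact Submonoid.subset_closure (Or.inl (Or.inl ⟨c, rfl⟩))
      · rw [reverse.commutes, map_mul]
      · rw [reverse.commutes, map_mul]
      · rw [reverse.commutes, AlgHom.commutes, ← Algebra.smul_def, ← Algebra.commutes,
          ← Algebra.smul_def, map_smul, map_smul]
    · refine ⟨?_, ⟨Q a, ?_, ?_⟩, fun x => ⟨-(QuadraticMap.polar Q a x • a - Q a • x), ?_⟩⟩
      · rw [reverse_ι]
        exact Submonoid.subset_closure (Or.inl (Or.inr ⟨a, rfl⟩))
      · rw [reverse_ι, ι_sq_scalar]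
      · rw [reverse_ι, ι_sq_scalar]
      · rw [reverse_ι, involute_ι, mul_neg, ι_mul_ι_mul_ι, map_neg]
    · have hr : reverse (1 + ι Q s * ι Q t) = 1 - ι Q s * ι Q t := by
        rw [map_add, reverse.map_one, reverse.map_mul, reverse_ι, reverse_ι, ι_mul_rev Q s t hst,
          sub_eq_add_neg]
      have hq := ι_quad Q s t hs hst
      refine ⟨?_, ⟨1, ?_, ?_⟩, fun x =>
        ⟨x + QuadraticMap.polar Q t x • s - QuadraticMap.polar Q s x • t, ?_⟩⟩
      · refine Submonoid.subset_closure (Or.inr ⟨t, s, ht, hs, ?_, ?_⟩)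
        · rw [QuadraticMap.polar_comm, hst]
        · rw [hr, ι_mul_rev Q s t hst, sub_eq_add_neg]
      · rw [hr, map_one, mul_sub, add_mul, add_mul, hq]
        noncomm_ring
      · rw [hr, map_one, mul_add, sub_mul, sub_mul, hq]
        noncomm_ring
      · rw [hr, map_sub, map_one, map_mul, involute_ι, involute_ι, neg_mul_neg]
        simp only [map_add, map_sub, map_smul, Algebra.smul_def]
        have h1 := ι_mul_rev Q s t hst
        have h2 : ι Q t * ι Q x = algebraMap F _ (QuadraticMap.polar Q t x) - ι Q x * ι Q t :=
          ι_mul_ι_comm t x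
        have h3 : ι Q s * ι Q x = algebraMap F _ (QuadraticMap.polar Q s x) - ι Q x * ι Q s :=
          ι_mul_ι_comm s x
        have h4 : ι Q s * algebraMap F _ (QuadraticMap.polar Q t x) =
            algebraMap F _ (QuadraticMap.polar Q t x) * ι Q s := (Algebra.commutes _ _).symm
        have hS : ι Q s * ι Q s = 0 := by rw [ι_sq_scalar, hs, map_zero]
        have hT : ι Q t * ι Q t = 0 := by rw [ι_sq_scalar, ht, map_zero]
        generalize algebraMap F (CliffordAlgebra Q) (QuadraticMap.polar Q t x) = b at *
        generalize algebraMap F (CliffordAlgebra Q) (QuadraticMap.polar Q s x) = a at *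
        generalize ι Q s = S at *
        generalize ι Q t = T at *
        generalize ι Q x = X at *
        have h5 : S * T * X = b * S - a * T + X * (S * T) := by
          rw [mul_assoc, h2, mul_sub, h4, ← mul_assoc, h3, sub_mul, mul_assoc]
          abel
        have h6 : S * T * X * (S * T) = 0 := by
          rw [h5, add_mul, sub_mul, mul_assoc b, ← mul_assoc S S, hS, mul_assoc a, ← mul_assoc T S,
            h1, neg_mul, mul_assoc S T T, hT, mul_assoc X, hq]
          simp
        rw [mul_sub, mul_one, add_mul, add_mul, h6, one_mul, h5]
        abel
  | one =>
    refine ⟨by rw [reverse.map_one]; exact one_mem _, ⟨1, by simp, by simp⟩, fun x => ⟨x, by simp⟩⟩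
  | mul a b _ _ iha ihb =>
    obtain ⟨ha, ⟨c, hc, hc'⟩, hax⟩ := iha
    obtain ⟨hb, ⟨d, hd, hd'⟩, hbx⟩ := ihb
    rw [reverse.map_mul]
    refine ⟨mul_mem hb ha, ⟨c * d, ?_, ?_⟩, fun x => ?_⟩
    · rw [mul_assoc, ← mul_assoc b, hd, Algebra.commutes d, ← mul_assoc, hc, map_mul]
    · rw [mul_assoc, ← mul_assoc (reverse a), hc', Algebra.commutes c, ← mul_assoc, hd', mul_comm c,
        map_mul]
    · obtain ⟨y, hy⟩ := hbx x
      obtain ⟨z, hz⟩ := hax y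
      refine ⟨z, ?_⟩
      rw [← hz, ← hy, map_mul]
      simp only [mul_assoc]

/-- An invertible element of the Lipschitz monoid has inverse `c⁻¹ α(p)` for some `c ∈ F`, where
`α` is the reversal. -/
theorem lip_inv {Q : QuadraticForm F V} {p : (CliffordAlgebra Q)ˣ} (hp : ↑p ∈ lipMonoid Q) :
    ∃ c : F, (↑p⁻¹ : CliffordAlgebra Q) = algebraMap F _ c * reverse (p : CliffordAlgebra Q) := by
  obtain ⟨-, ⟨c, hc, -⟩, -⟩ := lip_props hp
  have hc0 : c ≠ 0 := by
    rintro rfl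
    rw [map_zero] at hc
    have h0 : reverse (p : CliffordAlgebra Q) = 0 := by
      rw [← p.inv_mul_cancel_left (reverse (p : CliffordAlgebra Q)), hc, mul_zero]
    have h1 : (p : CliffordAlgebra Q) = 0 := by
      rw [← reverse_reverse (p : CliffordAlgebra Q), h0, map_zero]
    exact p.ne_zero h1
  refine ⟨c⁻¹, ?_⟩
  rw [← p.inv_mul_cancel_left (reverse (p : CliffordAlgebra Q)), hc, ← Algebra.commutes,
    ← mul_assoc, ← map_mul, inv_mul_cancel₀ hc0, map_one, one_mul]

/-- The Lipschitz group `Lip^×(V, Q)`: all invertible elements of the Lipschitz monoid. -/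
def lipGroup (Q : QuadraticForm F V) : Subgroup (CliffordAlgebra Q)ˣ where
  carrier := {p | (p : CliffordAlgebra Q) ∈ lipMonoid Q}
  one_mem' := one_mem (lipMonoid Q)
  mul_mem' := fun ha hb => (lipMonoid Q).mul_mem ha hb
  inv_mem' := by
    intro p hp
    obtain ⟨c, hc⟩ := lip_inv hp
    change (↑p⁻¹ : CliffordAlgebra Q) ∈ lipMonoid Q
    rw [hc]
    exact mul_mem (Submonoid.subset_closure (Or.inl (Or.inl ⟨c, rfl⟩))) (lip_props hp).1

/-! ### The twisted adjoint representation -/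

theorem twist_mem {Q : QuadraticForm F V} (p : lipGroup Q) (x : V) :
    ∃ y, (p.1 : CliffordAlgebra Q) * ι Q x * involute (↑p.1⁻¹ : CliffordAlgebra Q) = ι Q y := by
  have hp : (p.1 : CliffordAlgebra Q) ∈ lipMonoid Q := p.2
  obtain ⟨c, hc⟩ := lip_inv hp
  obtain ⟨y, hy⟩ := (lip_props hp).2.2 x
  refine ⟨c • y, ?_⟩
  rw [hc, map_mul, AlgHom.commutes, ← mul_assoc, ← Algebra.commutes, mul_assoc, hy, map_smul,
    Algebra.smul_def]

/-- The vector `p x σ(p)⁻¹`, where `σ` is the main involution. -/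
def xiFun {Q : QuadraticForm F V} (p : lipGroup Q) (x : V) : V := (twist_mem p x).choose

theorem ι_xiFun {Q : QuadraticForm F V} (p : lipGroup Q) (x : V) :
    ι Q (xiFun p x) =
      (p.1 : CliffordAlgebra Q) * ι Q x * involute (↑p.1⁻¹ : CliffordAlgebra Q) :=
  (twist_mem p x).choose_spec.symm

theorem xiFun_one {Q : QuadraticForm F V} (x : V) : xiFun (1 : lipGroup Q) x = x :=
  ι_inj Q (by rw [ι_xiFun]; simp)

theorem xiFun_mul {Q : QuadraticForm F V} (p q : lipGroup Q) (x : V) :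
    xiFun (p * q) x = xiFun p (xiFun q x) :=
  ι_inj Q (by
    rw [ι_xiFun, ι_xiFun, ι_xiFun]
    simp only [Subgroup.coe_mul, mul_inv_rev, Units.val_mul, map_mul, mul_assoc])

/-- `ξ_p : V → V, x ↦ p x σ(p)⁻¹` as a linear bijection. -/
def xiEquiv {Q : QuadraticForm F V} (p : lipGroup Q) : V ≃ₗ[F] V where
  toFun := xiFun p
  invFun := xiFun p⁻¹
  map_add' x y := ι_inj Q (by
    rw [map_add, ι_xiFun, ι_xiFun, ι_xiFun, map_add, mul_add, add_mul])
  map_smul' c x := ι_inj Q (by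
    rw [map_smul, ι_xiFun, ι_xiFun, map_smul, mul_smul_comm, smul_mul_assoc, RingHom.id_apply])
  left_inv x := by rw [← xiFun_mul, inv_mul_cancel, xiFun_one]
  right_inv x := by rw [← xiFun_mul, mul_inv_cancel, xiFun_one]

theorem involute_mul_inv {Q : QuadraticForm F V} (p : (CliffordAlgebra Q)ˣ) :
    involute (p : CliffordAlgebra Q) * involute (↑p⁻¹ : CliffordAlgebra Q) = 1 := by
  rw [← map_mul, Units.mul_inv, map_one]

theorem involute_inv_mul {Q : QuadraticForm F V} (p : (CliffordAlgebra Q)ˣ) :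
    involute (↑p⁻¹ : CliffordAlgebra Q) * involute (p : CliffordAlgebra Q) = 1 := by
  rw [← map_mul, Units.inv_mul, map_one]

theorem mul_ι_rad {Q : QuadraticForm F V} {x : V} (hx : x ∈ rad Q) (m : CliffordAlgebra Q) :
    m * ι Q x = ι Q x * involute m := by
  induction m using CliffordAlgebra.induction with
  | algebraMap r => rw [AlgHom.commutes, Algebra.commutes]
  | ι a => rw [involute_ι, mul_neg, ι_mul_rev Q x a (mem_rad.1 hx a)]
  | mul a b ha hb => rw [map_mul, mul_assoc, hb, ← mul_assoc, ha, mul_assoc]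
  | add a b ha hb => rw [map_add, add_mul, mul_add, ha, hb]

theorem xiEquiv_mem {Q : QuadraticForm F V} (p : lipGroup Q) : xiEquiv p ∈ weakOrth Q := by
  refine ⟨fun x => ?_, fun x hx => ?_⟩
  · change Q (xiFun p x) = Q x
    have h1 := ι_xiFun p x
    have h2 := congrArg involute h1
    rw [map_mul, map_mul, involute_ι, involute_ι, involute_involute, mul_neg, neg_mul,
      neg_inj] at h2
    apply (algebraMap F (CliffordAlgebra Q)).injective
    rw [← ι_sq_scalar]
    nth_rw 1 [h1]
    rw [h2, mul_assoc, mul_assoc (involute _), ← mul_assoc (involute _), involute_inv_mul, one_mul,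
      mul_assoc, ← mul_assoc (ι Q x), ι_sq_scalar, ← mul_assoc, ← Algebra.commutes, mul_assoc,
      Units.mul_inv, mul_one]
  · apply ι_inj Q
    change ι Q (xiFun p x) = ι Q x
    rw [ι_xiFun, mul_ι_rad hx, mul_assoc, involute_mul_inv, mul_one]

/-- The twisted adjoint representation `ξ : Lip^×(V, Q) → O'(V, Q)`, `p ↦ ξ_p`. -/
def xi (Q : QuadraticForm F V) : lipGroup Q →* weakOrth Q where
  toFun p := ⟨xiEquiv p, xiEquiv_mem p⟩
  map_one' := Subtype.ext (LinearEquiv.ext fun x => xiFun_one x)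
  map_mul' p q := Subtype.ext (LinearEquiv.ext fun x => xiFun_mul p q x)

/-! ### The group of points -/

/-- `p ↦ F p`, from the units of the Clifford algebra to points (one-dimensional subspaces) of the
projective space on the Clifford algebra. A point spanned by a unit is invertible with respect to
the multiplication of subspaces, which satisfies `(F p) (F q) = F (p q)`. -/
def point (Q : QuadraticForm F V) :
    (CliffordAlgebra Q)ˣ →* (Submodule F (CliffordAlgebra Q))ˣ :=
  Units.map (Submodule.spanSingleton F).toMonoidHom

theorem coe_point {Q : QuadraticForm F V} (p : (CliffordAlgebra Q)ˣ) :
    (point Q p : Submodule F (CliffordAlgebra Q)) =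
      Submodule.span F {(p : CliffordAlgebra Q)} := rfl

/-- The group of points `𝒢(V, Q) = {F p ∣ p ∈ Lip^×(V, Q)}` with `(F p) (F q) = F (p q)`. -/
def ptGroup (Q : QuadraticForm F V) : Subgroup (Submodule F (CliffordAlgebra Q))ˣ :=
  (lipGroup Q).map (point Q)

/-- The subset `𝒢_i(V, Q)` of all points of `𝒢(V, Q)` that are contained in the even part
(`i = 0`) or the odd part (`i = 1`) of the Clifford algebra. -/
def ptPart (Q : QuadraticForm F V) (i : ZMod 2) : Set (ptGroup Q) :=
  {X | (X.1 : Submodule F (CliffordAlgebra Q)) ≤ evenOdd Q i}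

theorem ker_point_le (Q : QuadraticForm F V) :
    ((point Q).subgroupMap (lipGroup Q)).ker ≤
      ((QuotientGroup.mk' (weakScalars Q)).comp (xi Q)).ker := by
  intro p hp
  have h1 : p.1 ∈ (point Q).ker := congrArg Subtype.val (MonoidHom.mem_ker.1 hp)
  unfold point at h1
  rw [Submodule.ker_unitsMap_spanSingleton] at h1
  obtain ⟨c, hc⟩ := h1
  have hc1 : (p.1 : CliffordAlgebra Q) = algebraMap F _ (c : F) := by rw [← hc]; rfl
  have h2 : xi Q p = 1 := by
    refine Subtype.ext (LinearEquiv.ext fun x => ι_inj Q ?_)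
    change ι Q (xiFun p x) = ι Q x
    rw [ι_xiFun]
    have h3 := involute_mul_inv p.1
    rw [hc1, AlgHom.commutes] at h3
    rw [hc1, Algebra.commutes, mul_assoc, h3, mul_one]
  rw [MonoidHom.mem_ker, MonoidHom.comp_apply, h2, map_one]

/-- The homomorphism `θ : 𝒢(V, Q) → PO'(V, Q)` that sends `F p` to the coset of `ξ_p`. -/
def theta (Q : QuadraticForm F V) : ptGroup Q →* projWeakOrth Q :=
  ((point Q).subgroupMap (lipGroup Q)).liftOfSurjective
    ((point Q).subgroupMap_surjective (lipGroup Q))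
    ⟨(QuotientGroup.mk' (weakScalars Q)).comp (xi Q), ker_point_le Q⟩

theorem theta_point (Q : QuadraticForm F V) (p : lipGroup Q) :
    theta Q ((point Q).subgroupMap (lipGroup Q) p) = QuotientGroup.mk (xi Q p) :=
  MonoidHom.liftOfRightInverse_comp_apply _ _ _ _ p

end

end ProjMetric

namespace ProjMetric

open CliffordAlgebra

noncomputable section

variable {F : Type u} {V : Type v} [Field F] [AddCommGroup V] [Module F V]

/-! ### Reflections and Siegel transformations -/

/-! Surjectivity is a Cartan–Dieudonné argument: `exists_fixSpace_lt` composes a weak isometry φ ≠ 1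
with some ξ_p so that the fixed space grows strictly. If some displacement φx - x is non-singular, a
reflection does it. Otherwise all displacements are singular and mutually orthogonal. Then either
one of them is outside the radical and a Siegel transformation 1 + st works, or all lie in the
radical and a transvection works.

The radical is non-zero and fixed elementwise, so -id is in O' only if it equals id, and ker θ
consists of the points Fp with ξ_p = id. For such p, the vectors commute with p in the graded sense,
and contractions force p into the subalgebra generated by the radical (`mem_adjoin_rad`). If Q
vanishes on the radical, projecting the radical away is an isometric map and induces a
parity-preserving algebra endomorphism that sends p to a non-zero scalar; hence p is not odd. As
Lipschitz elements are homogeneous, the parity claims of (a), (b) and (c) follow.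

If a is a non-singular radical vector, then ξ_a = id and multiplication by a switches parity, so
even points already give all of PO'. The kernel points are exhibited as families over c ∈ F: 1 + c
st in the singular case, a + cb and a(a + cb) otherwise, with s, t and a, b independent radical
vectors. -/

theorem xi_apply_eq {Q : QuadraticForm F V} {p : lipGroup Q} {x y : V}
    (h : (p.1 : CliffordAlgebra Q) * ι Q x = ι Q y * involute (p.1 : CliffordAlgebra Q)) :
    (xi Q p).1 x = y := by
  apply ι_inj Q
  change ι Q (xiFun p x) = ι Q y
  rw [ι_xiFun, h, mul_assoc, involute_mul_inv, mul_one]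

/-- A non-singular vector as an element of the Lipschitz group. -/
def vecLip (Q : QuadraticForm F V) (a : V) (ha : Q a ≠ 0) : lipGroup Q :=
  ⟨⟨ι Q a, algebraMap F _ (Q a)⁻¹ * ι Q a,
    by rw [← mul_assoc, ← Algebra.commutes, mul_assoc, ι_sq_scalar, ← map_mul,
      inv_mul_cancel₀ ha, map_one],
    by rw [mul_assoc, ι_sq_scalar, ← map_mul, inv_mul_cancel₀ ha, map_one]⟩,
    Submonoid.subset_closure (Or.inl (Or.inr ⟨a, rfl⟩))⟩

@[simp]
theorem coe_vecLip (Q : QuadraticForm F V) (a : V) (ha : Q a ≠ 0) :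
    ((vecLip Q a ha).1 : CliffordAlgebra Q) = ι Q a := rfl

theorem xi_vecLip (Q : QuadraticForm F V) (a : V) (ha : Q a ≠ 0) (x : V) :
    (xi Q (vecLip Q a ha)).1 x = x - ((Q a)⁻¹ * QuadraticMap.polar Q a x) • a := by
  apply xi_apply_eq
  rw [coe_vecLip, involute_ι, mul_neg, map_sub, sub_mul, map_smul, smul_mul_assoc, ι_sq_scalar,
    Algebra.smul_def, ← map_mul (algebraMap F (CliffordAlgebra Q)),
    ι_mul_ι_comm a x, mul_right_comm, inv_mul_cancel₀ ha, one_mul]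
  abel

/-- The element `1 + s t`, where `s` and `t` span a totally singular subspace, of the
Lipschitz group. -/
def siegelLip (Q : QuadraticForm F V) (s t : V) (hs : Q s = 0) (ht : Q t = 0)
    (hst : QuadraticMap.polar Q s t = 0) : lipGroup Q :=
  ⟨⟨1 + ι Q s * ι Q t, 1 - ι Q s * ι Q t,
    by rw [mul_sub, add_mul, add_mul, ι_quad Q s t hs hst]; noncomm_ring,
    by rw [mul_add, sub_mul, sub_mul, ι_quad Q s t hs hst]; noncomm_ring⟩,
    Submonoid.subset_closure (Or.inr ⟨s, t, hs, ht, hst, rfl⟩)⟩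

@[simp]
theorem coe_siegelLip (Q : QuadraticForm F V) (s t : V) (hs : Q s = 0) (ht : Q t = 0)
    (hst : QuadraticMap.polar Q s t = 0) :
    ((siegelLip Q s t hs ht hst).1 : CliffordAlgebra Q) = 1 + ι Q s * ι Q t := rfl

theorem xi_siegelLip (Q : QuadraticForm F V) (s t : V) (hs : Q s = 0) (ht : Q t = 0)
    (hst : QuadraticMap.polar Q s t = 0) (x : V) :
    (xi Q (siegelLip Q s t hs ht hst)).1 x =
      x + QuadraticMap.polar Q t x • s - QuadraticMap.polar Q s x • t := by
  apply xi_apply_eq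
  have hS : ι Q s * (ι Q s * ι Q t) = 0 := by
    rw [← mul_assoc, ι_sq_scalar, hs, map_zero, zero_mul]
  have hT : ι Q t * (ι Q s * ι Q t) = 0 := by
    rw [← mul_assoc, ι_mul_rev Q s t hst, neg_mul, mul_assoc, ι_sq_scalar, ht, map_zero, mul_zero,
      neg_zero]
  have h : ι Q s * ι Q t * ι Q x = QuadraticMap.polar Q t x • ι Q s -
      QuadraticMap.polar Q s x • ι Q t + ι Q x * (ι Q s * ι Q t) := by
    rw [mul_assoc, ι_mul_ι_comm t x, mul_sub, ← Algebra.commutes, ← Algebra.smul_def, ← mul_assoc,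
      ι_mul_ι_comm s x, sub_mul, ← Algebra.smul_def, mul_assoc]
    abel
  rw [coe_siegelLip, map_add, map_one, map_mul, involute_ι, involute_ι, neg_mul_neg, add_mul, h,
    map_sub, map_add, map_smul, map_smul, sub_mul, add_mul, smul_mul_assoc,
    smul_mul_assoc, mul_add, mul_add, mul_add, hS, hT]
  simp only [one_mul, mul_one, add_zero]
  abel

/-- A singular t gives 1 + st. For non-singular t, adding a multiple cs changes neither Q(t) nor
B(t, ·), and the reflections in t + cs and then t compose to z ↦ z - c Q(t)⁻¹ B(t, z) s; the choice
c = -Q(t) normalises the factor. -/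
theorem exists_xi_transvection (Q : QuadraticForm F V) {s : V} (hs : s ∈ rad Q) (hQs : Q s = 0)
    (t : V) : ∃ p, ∀ z, (xi Q p).1 z = z + QuadraticMap.polar Q t z • s := by
  have hB : ∀ z, QuadraticMap.polar Q s z = 0 := mem_rad.1 hs
  by_cases ht : Q t = 0
  · exact ⟨siegelLip Q s t hQs ht (hB t), fun z => by rw [xi_siegelLip, hB z, zero_smul, sub_zero]⟩
  · have hsum : ∀ c : F, Q (t + c • s) = Q t := fun c => by
      rw [QuadraticMap.map_add Q, QuadraticMap.map_smul, hQs, QuadraticMap.polar_smul_right,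
        QuadraticMap.polar_comm, hB]
      simp
    have hpol : ∀ (c : F) z, QuadraticMap.polar Q (t + c • s) z = QuadraticMap.polar Q t z :=
      fun c z => by
        rw [QuadraticMap.polar_add_left, QuadraticMap.polar_smul_left, hB, smul_zero, add_zero]
    refine ⟨vecLip Q t ht * vecLip Q (t + (-Q t) • s) (by rwa [hsum]), fun z => ?_⟩
    rw [map_mul, Subgroup.coe_mul, LinearEquiv.mul_apply, xi_vecLip, xi_vecLip, hsum, hpol]
    rw [QuadraticMap.polar_sub_right, QuadraticMap.polar_smul_right,
      QuadraticMap.polar_comm Q t (t + _), hpol, QuadraticMap.polar_self]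
    simp only [smul_eq_mul]
    match_scalars
    · ring
    · field_simp
      ring
    · field_simp

/-! ### Surjectivity of the twisted adjoint representation -/

/-- The subspace of all vectors that are fixed under `φ`. -/
def fixSpace (φ : V ≃ₗ[F] V) : Submodule F V := LinearMap.eqLocus (φ : V →ₗ[F] V) LinearMap.id

@[simp]
theorem mem_fixSpace {φ : V ≃ₗ[F] V} {x : V} : x ∈ fixSpace φ ↔ φ x = x := Iff.rfl

theorem polar_weakOrth {Q : QuadraticForm F V} (φ : weakOrth Q) (x y : V) :
    QuadraticMap.polar Q (φ.1 x) (φ.1 y) = QuadraticMap.polar Q x y := by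
  simp only [QuadraticMap.polar, ← map_add, φ.2.1]

/-- Guarantees that reflections and Siegel transformations built from displacements of φ keep every
fixed vector of φ. -/
theorem polar_sub_fixed {Q : QuadraticForm F V} (φ : weakOrth Q) (x : V) {y : V}
    (hy : φ.1 y = y) : QuadraticMap.polar Q (φ.1 x - x) y = 0 := by
  rw [QuadraticMap.polar_sub_left, sub_eq_zero]
  conv_lhs => rw [← hy]
  exact polar_weakOrth φ x y

theorem apply_sub_weakOrth {Q : QuadraticForm F V} (φ : weakOrth Q) (x : V) :
    Q (φ.1 x - x) = QuadraticMap.polar Q (φ.1 x - x) (φ.1 x) := by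
  rw [QuadraticMap.polar_sub_left, QuadraticMap.polar_self, φ.2.1, sub_eq_add_neg (φ.1 x),
    QuadraticMap.map_add Q, QuadraticMap.map_neg, QuadraticMap.polar_neg_right, φ.2.1,
    QuadraticMap.polar_comm Q x]
  ring

theorem apply_sub_weakOrth' {Q : QuadraticForm F V} (φ : weakOrth Q) (x : V) :
    Q (φ.1 x - x) = -QuadraticMap.polar Q (φ.1 x - x) x := by
  rw [QuadraticMap.polar_sub_left, QuadraticMap.polar_self, sub_eq_add_neg (φ.1 x),
    QuadraticMap.map_add Q, QuadraticMap.map_neg, QuadraticMap.polar_neg_right, φ.2.1]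
  ring

/-- A functional that vanishes on the radical annihilates the kernel of the polar form, so in finite
dimension it is represented as B(t, ·). -/
theorem exists_polar_separating [FiniteDimensional F V] (Q : QuadraticForm F V)
    {W : Submodule F V} (hW : rad Q ≤ W) {x : V} (hx : x ∉ W) :
    ∃ t, QuadraticMap.polar Q t x = 1 ∧ ∀ z ∈ W, QuadraticMap.polar Q t z = 0 := by
  obtain ⟨f, hfx, hf⟩ := Submodule.exists_le_ker_of_notMem hx
  have hmem : f ∈ LinearMap.range Q.polarBilin.dualMap := by
    rw [LinearMap.range_dualMap_eq_dualAnnihilator_ker, Submodule.mem_dualAnnihilator]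
    exact fun w hw => hf (hW hw)
  obtain ⟨g, hg⟩ := hmem
  obtain ⟨t, rfl⟩ := (Module.evalEquiv F V).surjective g
  have ht : ∀ z, QuadraticMap.polar Q t z = f z := fun z => by
    rw [← hg, QuadraticMap.polar_comm]
    simp
  refine ⟨(f x)⁻¹ • t, ?_, fun z hz => ?_⟩
  · rw [QuadraticMap.polar_smul_left, ht, smul_eq_mul, inv_mul_cancel₀ hfx]
  · rw [QuadraticMap.polar_smul_left, ht, LinearMap.mem_ker.1 (hf hz), smul_zero]

theorem exists_fixSpace_lt [FiniteDimensional F V] (Q : QuadraticForm F V) {φ : weakOrth Q}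
    (hφ : φ ≠ 1) : ∃ p, fixSpace φ.1 < fixSpace (xi Q p * φ).1 := by
  suffices h : ∃ p x, φ.1 x ≠ x ∧ (xi Q p).1 (φ.1 x) = x ∧ ∀ z, φ.1 z = z → (xi Q p).1 z = z by
    obtain ⟨p, x, hx, hpx, hz⟩ := h
    refine ⟨p, SetLike.lt_iff_le_and_exists.2 ⟨fun z hz' => ?_, x, hpx, hx⟩⟩
    change (xi Q p).1 (φ.1 z) = z
    rw [mem_fixSpace.1 hz', hz z hz']
  by_cases hA : ∃ x, Q (φ.1 x - x) ≠ 0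
  · obtain ⟨x, hx⟩ := hA
    refine ⟨vecLip Q _ hx, x, fun h => hx (by rw [h, sub_self, QuadraticMap.map_zero]), ?_,
      fun z hz => ?_⟩
    · rw [xi_vecLip, ← apply_sub_weakOrth, inv_mul_cancel₀ hx, one_smul, sub_sub_cancel]
    · rw [xi_vecLip, polar_sub_fixed φ x hz, mul_zero, zero_smul, sub_zero]
  push Not at hA
  -- Polarisation of the identity Q(φx - x) = 0.
  have hortho : ∀ x y, QuadraticMap.polar Q (φ.1 x - x) (φ.1 y - y) = 0 := fun x y => by
    have h := hA (x + y)
    rwa [map_add, add_sub_add_comm, QuadraticMap.map_add Q, hA, hA, zero_add, zero_add] at h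
  -- Thus (x, y) ↦ B(φx - x, y) is alternating, hence skew-symmetric.
  have halt : ∀ x, QuadraticMap.polar Q (φ.1 x - x) x = 0 := fun x => by
    rw [← neg_eq_zero, ← apply_sub_weakOrth', hA]
  by_cases hB : ∃ x y, QuadraticMap.polar Q (φ.1 x - x) y ≠ 0
  · obtain ⟨x, y, hxy⟩ := hB
    set c := QuadraticMap.polar Q (φ.1 x - x) y with hc
    have hyx : QuadraticMap.polar Q (φ.1 y - y) x = -c := by
      have h := halt (x + y)
      rw [map_add, add_sub_add_comm, QuadraticMap.polar_add_left, QuadraticMap.polar_add_right,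
        QuadraticMap.polar_add_right, halt, halt, zero_add, add_zero, add_comm] at h
      exact eq_neg_of_add_eq_zero_left h
    -- Since B(φy - y, φx) = -c, the factor c⁻¹ makes the transformation subtract exactly φx - x
    -- from φx.
    refine ⟨siegelLip Q (c⁻¹ • (φ.1 x - x)) (φ.1 y - y) ?_ (hA y) ?_, x, fun h => hxy ?_, ?_,
      fun z hz => ?_⟩
    · rw [QuadraticMap.map_smul, hA, smul_zero]
    · rw [QuadraticMap.polar_smul_left, hortho, smul_zero]
    · rw [hc, h, sub_self, QuadraticMap.polar_zero_left]
    · have h1 : QuadraticMap.polar Q (φ.1 y - y) (φ.1 x) = -c := by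
        rw [← hyx, ← sub_eq_zero, ← QuadraticMap.polar_sub_right, hortho]
      have h2 : QuadraticMap.polar Q (φ.1 x - x) (φ.1 x) = 0 := by
        rw [← apply_sub_weakOrth, hA]
      rw [xi_siegelLip, h1, QuadraticMap.polar_smul_left, h2, smul_zero, zero_smul, sub_zero,
        smul_smul, neg_mul, mul_inv_cancel₀ hxy, neg_smul, one_smul]
      abel
    · rw [xi_siegelLip, QuadraticMap.polar_smul_left, polar_sub_fixed φ x hz,
        polar_sub_fixed φ y hz]
      simp
  push Not at hB
  obtain ⟨x, hx⟩ : ∃ x, φ.1 x ≠ x := by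
    by_contra! h
    exact hφ (Subtype.ext (LinearEquiv.ext h))
  obtain ⟨t, htx, ht⟩ := exists_polar_separating Q (W := fixSpace φ.1) (fun z hz => φ.2.2 z hz) hx
  -- All displacements are now singular radical vectors, so B(t, φx) = B(t, x) = 1 and the
  -- transvection along φx - x with -t takes φx back to x.
  obtain ⟨p, hp⟩ := exists_xi_transvection Q (s := φ.1 x - x) (mem_rad.2 (hB x)) (hA x) (-t)
  refine ⟨p, x, hx, ?_, fun z hz => ?_⟩
  · have h1 : QuadraticMap.polar Q t (φ.1 x) = 1 := by
      rw [← htx, ← sub_eq_zero, ← QuadraticMap.polar_sub_right, QuadraticMap.polar_comm, hB]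
    rw [hp, QuadraticMap.polar_neg_left, h1, neg_smul, one_smul]
    abel
  · rw [hp, QuadraticMap.polar_neg_left, ht z hz, neg_zero, zero_smul, add_zero]

/-- Every weak isometry is induced by an element of the Lipschitz group. -/
theorem xi_surjective [FiniteDimensional F V] (Q : QuadraticForm F V) :
    Function.Surjective (xi Q) := by
  intro φ
  induction h : fixSpace φ.1 using WellFoundedGT.induction generalizing φ with
  | ind W ih =>
    subst h
    by_cases hφ : φ = 1
    · exact ⟨1, by rw [hφ, map_one]⟩
    · obtain ⟨p, hp⟩ := exists_fixSpace_lt Q hφ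
      obtain ⟨q, hq⟩ := ih _ hp _ rfl
      exact ⟨p⁻¹ * q, by rw [map_mul, map_inv, hq, inv_mul_cancel_left]⟩

end

end ProjMetric
namespace ProjMetric

open CliffordAlgebra

section

variable {F : Type u} {V : Type v} [Field F] [AddCommGroup V] [Module F V]

/-! ### The twisted centralizer of the vectors -/

/-- Both sides are antiderivations in m that agree on scalars and vectors. Graded commutation with x
thereby becomes annihilation by a contraction. -/
theorem contractLeft_polarBilin (Q : QuadraticForm F V) (x : V) (m : CliffordAlgebra Q) :
    contractLeft (Q.polarBilin x) m = ι Q x * m - involute m * ι Q x := by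
  induction m using CliffordAlgebra.left_induction with
  | algebraMap r => rw [contractLeft_algebraMap, AlgHom.commutes, Algebra.commutes, sub_self]
  | add a b ha hb => rw [map_add, ha, hb, map_add, mul_add, add_mul]; abel
  | ι_mul m a hm =>
    rw [contractLeft_ι_mul, hm, map_mul, involute_ι, mul_sub, ← mul_assoc,
      ← mul_assoc, ← mul_assoc, ι_mul_ι_comm x a, sub_mul, ← Algebra.smul_def,
      QuadraticMap.polarBilin_apply_apply]
    noncomm_ring

theorem adjoin_ι_le {Q : QuadraticForm F V} {W : Submodule F V}
    {N : Submodule F (CliffordAlgebra Q)} (h1 : 1 ∈ N)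
    (hmul : ∀ w ∈ W, ∀ m ∈ N, ι Q w * m ∈ N) :
    Subalgebra.toSubmodule (Algebra.adjoin F (ι Q '' W)) ≤ N := by
  rw [Algebra.adjoin_eq_span, Submodule.span_le]
  intro m hm
  induction hm using Submonoid.closure_induction_left with
  | one => exact h1
  | mul_left a ha b _ hb =>
    obtain ⟨w, hw, rfl⟩ := ha
    exact hmul w hw b hb

theorem contractLeft_eq_zero_of_mem_adjoin {Q : QuadraticForm F V} {W : Submodule F V}
    {d : Module.Dual F V} (hd : ∀ w ∈ W, d w = 0) {m : CliffordAlgebra Q}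
    (hm : m ∈ Algebra.adjoin F (ι Q '' W)) : contractLeft d m = 0 := by
  refine adjoin_ι_le (N := LinearMap.ker (contractLeft d)) (contractLeft_one Q d) ?_ hm
  intro w hw m hm
  rw [LinearMap.mem_ker] at hm ⊢
  rw [contractLeft_ι_mul, hm, hd w hw, zero_smul, mul_zero, sub_zero]

/-- W is spanned by e and W ∩ ker d; the Clifford relations move e to the left past the other
vectors and reduce e² to a scalar. -/
theorem exists_eq_add_ι_mul {Q : QuadraticForm F V} {W : Submodule F V} {d : Module.Dual F V}
    {e : V} (heW : e ∈ W) (he : d e = 1) {m : CliffordAlgebra Q}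
    (hm : m ∈ Algebra.adjoin F (ι Q '' W)) :
    ∃ a ∈ Algebra.adjoin F (ι Q '' (W ⊓ LinearMap.ker d : Submodule F V)),
      ∃ b ∈ Algebra.adjoin F (ι Q '' (W ⊓ LinearMap.ker d : Submodule F V)),
        m = a + ι Q e * b := by
  set A := Algebra.adjoin F (ι Q '' (W ⊓ LinearMap.ker d : Submodule F V)) with hA
  have key := adjoin_ι_le (Q := Q) (W := W)
    (N := Subalgebra.toSubmodule A ⊔
      (Subalgebra.toSubmodule A).map (LinearMap.mulLeft F (ι Q e))) ?_ ?_ hm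
  · obtain ⟨a, ha, _, ⟨b, hb, rfl⟩, rfl⟩ := Submodule.mem_sup.1 key
    exact ⟨a, ha, b, hb, rfl⟩
  · exact Submodule.mem_sup_left (one_mem A)
  · intro w hw m hm
    obtain ⟨a, ha, _, ⟨b, hb, rfl⟩, rfl⟩ := Submodule.mem_sup.1 hm
    have hw' : ι Q (w - d w • e) ∈ A := Algebra.subset_adjoin
      ⟨_, ⟨sub_mem hw (W.smul_mem _ heW), by simp [he]⟩, rfl⟩
    set w' := w - d w • e with hw'_def
    have hw_eq : ι Q w = ι Q w' + d w • ι Q e := by rw [hw'_def, map_sub, map_smul, sub_add_cancel]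
    -- The witnesses come from expanding (w' + d(w)e)(a + eb) with w'e = B(w', e) - ew' and e² =
    -- Q(e).
    refine Submodule.mem_sup.2
      ⟨ι Q w' * a + QuadraticMap.polar Q w' e • b + (d w * Q e) • b, ?_,
        _, ⟨d w • a - ι Q w' * b, ?_, rfl⟩, ?_⟩
    · exact add_mem (add_mem (A.mul_mem hw' ha) (A.smul_mem hb _)) (A.smul_mem hb _)
    · exact sub_mem (A.smul_mem ha _) (A.mul_mem hw' hb)
    · have h1 : ι Q w' * (ι Q e * b) =
          QuadraticMap.polar Q w' e • b - ι Q e * (ι Q w' * b) := by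
        rw [← mul_assoc, ι_mul_ι_comm, sub_mul, ← Algebra.smul_def, mul_assoc]
      have h2 : ι Q e * (ι Q e * b) = Q e • b := by
        rw [← mul_assoc, ι_sq_scalar, ← Algebra.smul_def]
      rw [LinearMap.mulLeft_apply, LinearMap.mulLeft_apply, hw_eq, add_mul, mul_add, mul_add, h1,
        smul_mul_assoc, smul_mul_assoc, h2, mul_sub, mul_smul_comm, smul_smul]
      abel

/-- Contraction by d kills a and b, so it maps a + eb to b; hence b = 0. -/
theorem mem_adjoin_inf_ker {Q : QuadraticForm F V} {W : Submodule F V} {d : Module.Dual F V}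
    {e : V} (heW : e ∈ W) (he : d e = 1) {m : CliffordAlgebra Q}
    (hm : m ∈ Algebra.adjoin F (ι Q '' W)) (hdm : contractLeft d m = 0) :
    m ∈ Algebra.adjoin F (ι Q '' (W ⊓ LinearMap.ker d : Submodule F V)) := by
  obtain ⟨a, ha, b, hb, rfl⟩ := exists_eq_add_ι_mul heW he hm
  have hd : ∀ w ∈ W ⊓ LinearMap.ker d, d w = 0 := fun w hw => hw.2
  rw [map_add, contractLeft_ι_mul, contractLeft_eq_zero_of_mem_adjoin hd ha,
    contractLeft_eq_zero_of_mem_adjoin hd hb, he, one_smul, mul_zero, sub_zero, zero_add] at hdm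
  rwa [hdm, mul_zero, add_zero]

theorem adjoin_ι_top (Q : QuadraticForm F V) :
    Algebra.adjoin F (ι Q '' (⊤ : Submodule F V)) = ⊤ := by
  rw [Submodule.top_coe, Set.image_univ, CliffordAlgebra.adjoin_range_ι]

/-- An element that commutes with all vectors in the graded sense belongs to the subalgebra that
is generated by the radical. -/
theorem mem_adjoin_rad [FiniteDimensional F V] {Q : QuadraticForm F V} {m : CliffordAlgebra Q}
    (hm : ∀ x, ι Q x * m = involute m * ι Q x) : m ∈ Algebra.adjoin F (ι Q '' rad Q) := by
  suffices h : ∀ W : Submodule F V, m ∈ Algebra.adjoin F (ι Q '' W) →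
      m ∈ Algebra.adjoin F (ι Q '' rad Q) from
    h ⊤ (by rw [adjoin_ι_top]; exact Algebra.mem_top)
  intro W
  induction W using WellFoundedLT.induction with
  | ind W ih =>
    intro hmW
    by_cases hW : W ≤ rad Q
    · exact Algebra.adjoin_mono (Set.image_mono hW) hmW
    obtain ⟨w, hwW, hw⟩ := SetLike.not_le_iff_exists.1 hW
    rw [mem_rad] at hw
    push Not at hw
    obtain ⟨x, hx⟩ := hw
    -- The scaled w serves as e for the functional B(x, ·), whose kernel cuts W down strictly; the
    -- descent ends inside the radical.
    have he : Q.polarBilin x ((QuadraticMap.polar Q w x)⁻¹ • w) = 1 := by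
      rw [map_smul, QuadraticMap.polarBilin_apply_apply, smul_eq_mul, QuadraticMap.polar_comm Q x,
        inv_mul_cancel₀ hx]
    have heW := W.smul_mem (QuadraticMap.polar Q w x)⁻¹ hwW
    refine ih _ (lt_of_le_of_ne inf_le_left fun h => ?_) (mem_adjoin_inf_ker heW he hmW ?_)
    · have h0 : Q.polarBilin x _ = 0 := (inf_eq_left.1 h) heW
      exact one_ne_zero (he.symm.trans h0)
    · rw [contractLeft_polarBilin, hm, sub_self]

/-! ### Odd units -/

theorem evenOdd_one_algebraMap {Q : QuadraticForm F V} {c : F}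
    (h : algebraMap F (CliffordAlgebra Q) c ∈ evenOdd Q 1) :
    algebraMap F (CliffordAlgebra Q) c = 0 :=
  (Submodule.disjoint_def.1 (evenOdd_isCompl Q).disjoint) _
    (by rw [Algebra.algebraMap_eq_smul_one]
        exact Submodule.smul_mem _ _ (Submodule.one_le.1 (one_le_evenOdd_zero Q))) h

theorem map_mem_evenOdd_one {Q : QuadraticForm F V} (f : Q →qᵢ Q) {m : CliffordAlgebra Q}
    (hm : m ∈ evenOdd Q 1) : CliffordAlgebra.map f m ∈ evenOdd Q 1 := by
  induction m, hm using CliffordAlgebra.odd_induction with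
  | ι v => rw [map_apply_ι]; exact ι_mem_evenOdd_one Q _
  | add _ _ _ _ hx hy => rw [map_add]; exact add_mem hx hy
  | ι_mul_ι_mul a b _ _ hx =>
    rw [map_mul, map_mul, map_apply_ι, map_apply_ι]
    have := evenOdd_mul_le Q 0 1 (Submodule.mul_mem_mul (ι_mul_ι_mem_evenOdd_zero Q (f a) (f b)) hx)
    rwa [zero_add] at this

/-- If the radical is totally singular, then no odd unit commutes with all vectors in the graded
sense. -/
theorem not_odd_of_graded_central [FiniteDimensional F V] {Q : QuadraticForm F V}
    (hQ : ∀ x ∈ rad Q, Q x = 0) (p : (CliffordAlgebra Q)ˣ)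
    (hp : ∀ x, ι Q x * (p : CliffordAlgebra Q) = involute (p : CliffordAlgebra Q) * ι Q x) :
    (p : CliffordAlgebra Q) ∉ evenOdd Q 1 := by
  intro hodd
  obtain ⟨W, hW⟩ := (rad Q).exists_isCompl
  let f : V →ₗ[F] V := W.subtype ∘ₗ W.projectionOnto (rad Q) hW.symm
  have hf_rad : ∀ x ∈ rad Q, f x = 0 := fun x hx => by
    simp [f, hx]
  have hf_sub : ∀ x, f x - x ∈ rad Q := fun x => by
    obtain ⟨r, hr, w, hw, rfl⟩ := Submodule.mem_sup.1
      (hW.sup_eq_top ▸ Submodule.mem_top : x ∈ rad Q ⊔ W)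
    have : f w = w := congrArg Subtype.val (Submodule.projectionOnto_apply_left hW.symm ⟨w, hw⟩)
    rw [map_add, hf_rad r hr, this, zero_add, sub_add_cancel_right]
    exact neg_mem hr
  -- Here f changes x only by a singular radical vector, which does not affect Q.
  let g : Q →qᵢ Q := ⟨f, fun x => by
    change Q (f x) = Q x
    rw [← sub_add_cancel (f x) x, QuadraticMap.map_add Q, hQ _ (hf_sub x),
      mem_rad.1 (hf_sub x) x, zero_add, add_zero]⟩
  have hscalar : ∀ m ∈ Algebra.adjoin F (ι Q '' rad Q),
      CliffordAlgebra.map g m ∈ (⊥ : Subalgebra F (CliffordAlgebra Q)) := by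
    intro m hm
    suffices h : Algebra.adjoin F (ι Q '' rad Q) ≤
        (⊥ : Subalgebra F (CliffordAlgebra Q)).comap (CliffordAlgebra.map g) from h hm
    rw [Algebra.adjoin_le_iff]
    rintro _ ⟨x, hx, rfl⟩
    have : CliffordAlgebra.map g (ι Q x) = 0 := by
      rw [map_apply_ι]
      change ι Q (f x) = 0
      rw [hf_rad x hx, map_zero]
    rw [SetLike.mem_coe, Subalgebra.mem_comap, this]
    exact zero_mem _
  obtain ⟨c, hc⟩ := Algebra.mem_bot.1 (hscalar _ (mem_adjoin_rad hp))
  -- The image of p is an odd scalar, hence zero, yet it is a unit.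
  have h0 := evenOdd_one_algebraMap (hc ▸ map_mem_evenOdd_one g hodd)
  exact (p.isUnit.map (CliffordAlgebra.map g)).ne_zero (hc.symm.trans h0)

end

end ProjMetric
namespace ProjMetric

open CliffordAlgebra

noncomputable section

variable {F : Type u} {V : Type v} [Field F] [AddCommGroup V] [Module F V]

/-! ### Points and the kernel of `theta` -/

/-- The point `F p` of the group `𝒢(V, Q)`, where `p` belongs to the Lipschitz group. -/
def lipPoint (Q : QuadraticForm F V) : lipGroup Q →* ptGroup Q :=
  (point Q).subgroupMap (lipGroup Q)

theorem lipPoint_surjective (Q : QuadraticForm F V) : Function.Surjective (lipPoint Q) :=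
  (point Q).subgroupMap_surjective (lipGroup Q)

theorem theta_lipPoint (Q : QuadraticForm F V) (p : lipGroup Q) :
    theta Q (lipPoint Q p) = QuotientGroup.mk (xi Q p) := theta_point Q p

theorem lipPoint_mem_ptPart {Q : QuadraticForm F V} {p : lipGroup Q} {i : ZMod 2} :
    lipPoint Q p ∈ ptPart Q i ↔ (p.1 : CliffordAlgebra Q) ∈ evenOdd Q i :=
  Submodule.span_singleton_le_iff_mem _ _

theorem exists_smul_of_lipPoint_eq {Q : QuadraticForm F V} {p q : lipGroup Q}
    (h : lipPoint Q p = lipPoint Q q) :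
    ∃ c : F, c • (p.1 : CliffordAlgebra Q) = (q.1 : CliffordAlgebra Q) := by
  have h1 : Submodule.span F {(p.1 : CliffordAlgebra Q)} =
      Submodule.span F {(q.1 : CliffordAlgebra Q)} :=
    congrArg (fun X : ptGroup Q => (X.1 : Submodule F (CliffordAlgebra Q))) h
  exact Submodule.mem_span_singleton.1 (h1 ▸ Submodule.mem_span_singleton_self _)

theorem lipPoint_mem_ker_of_xi_eq_one {Q : QuadraticForm F V} {p : lipGroup Q}
    (h : xi Q p = 1) : lipPoint Q p ∈ (theta Q).ker := by
  rw [MonoidHom.mem_ker, theta_lipPoint, h, QuotientGroup.mk_one]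

/-- If ξ_p = -id, a non-zero radical vector s satisfies -s = s, so the characteristic is two and -id
= id. -/
theorem xi_eq_one_of_mem_ker {Q : QuadraticForm F V} (hQ : rad Q ≠ ⊥) {p : lipGroup Q}
    (h : lipPoint Q p ∈ (theta Q).ker) : xi Q p = 1 := by
  rw [MonoidHom.mem_ker, theta_lipPoint, QuotientGroup.eq_one_iff] at h
  rcases h with h | h
  · exact Subtype.ext h
  · obtain ⟨s, hs, hs0⟩ := Submodule.exists_mem_ne_zero_of_ne_bot hQ
    have h1 : -s = s := by
      conv_rhs => rw [← (xi Q p).2.2 s hs, h]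
      rfl
    have h2 : (2 : F) = 0 := by
      refine (smul_eq_zero.1 (?_ : (2 : F) • s = 0)).resolve_right hs0
      rw [two_smul]
      nth_rw 1 [← h1]
      exact neg_add_cancel s
    refine Subtype.ext (LinearEquiv.ext fun x => ?_)
    rw [h]
    change -x = x
    rw [neg_eq_iff_add_eq_zero, ← two_smul F, h2, zero_smul]

theorem graded_central_of_xi_eq_one {Q : QuadraticForm F V} {p : lipGroup Q} (h : xi Q p = 1)
    (x : V) : ι Q x * (p.1 : CliffordAlgebra Q) =
      involute (p.1 : CliffordAlgebra Q) * ι Q x := by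
  have h1 : (xi Q p).1 x = x := by rw [h]; rfl
  have h2 : ι Q x = (p.1 : CliffordAlgebra Q) * ι Q x *
      involute (↑p.1⁻¹ : CliffordAlgebra Q) := by
    conv_lhs => rw [← h1]
    exact ι_xiFun p x
  have h3 : ι Q x * involute (p.1 : CliffordAlgebra Q) = (p.1 : CliffordAlgebra Q) * ι Q x := by
    conv_lhs => rw [h2]
    rw [mul_assoc, involute_inv_mul, mul_one]
  have h4 := congrArg involute h3
  rwa [map_mul, map_mul, involute_ι, involute_involute, neg_mul, mul_neg, neg_inj] at h4

theorem xi_eq_one_not_odd [FiniteDimensional F V] {Q : QuadraticForm F V}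
    (hQ : ∀ x ∈ rad Q, Q x = 0) {p : lipGroup Q} (h : xi Q p = 1) :
    (p.1 : CliffordAlgebra Q) ∉ evenOdd Q 1 :=
  not_odd_of_graded_central hQ p.1 (graded_central_of_xi_eq_one h)

/-- All generators of the monoid are homogeneous, and homogeneity survives products. -/
theorem even_or_odd_of_mem_lipMonoid {Q : QuadraticForm F V} {m : CliffordAlgebra Q}
    (hm : m ∈ lipMonoid Q) : m ∈ evenOdd Q 0 ∨ m ∈ evenOdd Q 1 := by
  have hone : (1 : CliffordAlgebra Q) ∈ evenOdd Q 0 :=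
    Submodule.one_le.1 (one_le_evenOdd_zero Q)
  have hmul : ∀ {i j : ZMod 2} {x y : CliffordAlgebra Q} (k : ZMod 2), i + j = k →
      x ∈ evenOdd Q i → y ∈ evenOdd Q j → x * y ∈ evenOdd Q k :=
    fun k hk hx hy => hk ▸ evenOdd_mul_le Q _ _ (Submodule.mul_mem_mul hx hy)
  induction hm using Submonoid.closure_induction with
  | mem m hm =>
    rcases hm with (⟨c, rfl⟩ | ⟨a, rfl⟩) | ⟨s, t, -, -, -, rfl⟩
    · rw [Algebra.algebraMap_eq_smul_one]
      exact Or.inl (Submodule.smul_mem _ _ hone)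
    · exact Or.inr (ι_mem_evenOdd_one Q a)
    · exact Or.inl (add_mem hone (ι_mul_ι_mem_evenOdd_zero Q s t))
  | one => exact Or.inl hone
  | mul a b _ _ iha ihb =>
    rcases iha with ha | ha <;> rcases ihb with hb | hb
    · exact Or.inl (hmul 0 (by decide) ha hb)
    · exact Or.inr (hmul 1 (by decide) ha hb)
    · exact Or.inr (hmul 1 (by decide) ha hb)
    · exact Or.inl (hmul 0 (by decide) ha hb)

theorem xi_siegelLip_eq_one {Q : QuadraticForm F V} {s t : V} (hs : s ∈ rad Q) (ht : t ∈ rad Q)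
    (hs0 : Q s = 0) (ht0 : Q t = 0) (hst : QuadraticMap.polar Q s t = 0) :
    xi Q (siegelLip Q s t hs0 ht0 hst) = 1 := by
  refine Subtype.ext (LinearEquiv.ext fun x => ?_)
  rw [xi_siegelLip, mem_rad.1 hs, mem_rad.1 ht, zero_smul, zero_smul, add_zero, sub_zero]
  rfl

theorem xi_vecLip_eq_one {Q : QuadraticForm F V} {a : V} (ha : a ∈ rad Q) (ha0 : Q a ≠ 0) :
    xi Q (vecLip Q a ha0) = 1 := by
  refine Subtype.ext (LinearEquiv.ext fun x => ?_)
  rw [xi_vecLip, mem_rad.1 ha, mul_zero, zero_smul, sub_zero]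
  rfl

/-! ### Families of points -/

theorem lift_mk_le_of_injective {Q : QuadraticForm F V} {S : Set (ptGroup Q)} (f : F → ptGroup Q)
    (hf : Function.Injective f) (hS : ∀ c, f c ∈ S) :
    Cardinal.lift.{v} (Cardinal.mk F) ≤ Cardinal.mk S := by
  rw [← Cardinal.mk_uLift]
  exact Cardinal.mk_le_of_injective (f := fun c : ULift.{v} F => (⟨f c.down, hS _⟩ : S))
    fun c d h => ULift.down_injective (hf (congrArg Subtype.val h))

/-- Contraction by a functional d with d(b) = 0 ≠ d(a) turns k + c ab into c d(a) b. This is the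
independence of 1 and ab that separates the points below. -/
theorem ι_mul_ι_coeff_eq_zero {Q : QuadraticForm F V} {a b : V} (ha : a ∉ Submodule.span F {b})
    (hb : b ≠ 0) {k c : F}
    (h : algebraMap F (CliffordAlgebra Q) k + c • (ι Q a * ι Q b) = 0) : c = 0 := by
  obtain ⟨d, hda, hd⟩ := Submodule.exists_le_ker_of_notMem ha
  have hdb : d b = 0 := hd (Submodule.mem_span_singleton_self b)
  have h1 := congrArg (contractLeft d) h
  rw [map_add, map_smul, contractLeft_algebraMap, contractLeft_ι_mul, contractLeft_ι, hdb,
    map_zero, map_zero, mul_zero, sub_zero, zero_add, smul_smul, ← map_smul,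
    ← map_zero (ι Q)] at h1
  exact (mul_eq_zero.1 ((smul_eq_zero.1 (ι_inj Q h1)).resolve_right hb)).resolve_right hda

theorem coeff_eq_of_smul_eq {Q : QuadraticForm F V} {a b : V} (ha : a ∉ Submodule.span F {b})
    (hb : b ≠ 0) {k c r s : F} (hk : k ≠ 0)
    (h : c • (algebraMap F (CliffordAlgebra Q) k + r • (ι Q a * ι Q b)) =
      algebraMap F (CliffordAlgebra Q) k + s • (ι Q a * ι Q b)) : r = s := by
  have h1 : algebraMap F (CliffordAlgebra Q) (c * k - k) +
      (c * r - s) • (ι Q a * ι Q b) = 0 := by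
    rw [map_sub, map_mul, sub_smul, mul_smul, ← Algebra.smul_def, ← sub_eq_zero.2 h, smul_add]
    abel
  have h2 := ι_mul_ι_coeff_eq_zero ha hb h1
  rw [h2, zero_smul, add_zero, map_eq_zero_iff _ (algebraMap F (CliffordAlgebra Q)).injective,
    sub_eq_zero] at h1
  rw [mul_eq_right₀ hk] at h1
  rwa [h1, one_mul, sub_eq_zero] at h2

theorem exists_mem_notMem_span {W : Submodule F V} (hW : 2 ≤ Module.finrank F W) (t : V) :
    ∃ s ∈ W, s ∉ Submodule.span F {t} := by
  by_contra! h
  have h1 : Module.finrank F W ≤ 1 :=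
    (Submodule.finrank_mono h).trans (finrank_span_le_card (R := F) {t})
  omega

theorem notMem_span_singleton_symm {a b : V} (ha : a ≠ 0) (h : b ∉ Submodule.span F {a}) :
    a ∉ Submodule.span F {b} ∧ b ≠ 0 := by
  refine ⟨fun hab => h ?_, fun hb => h (hb ▸ zero_mem _)⟩
  obtain ⟨c, rfl⟩ := Submodule.mem_span_singleton.1 hab
  have hc : c ≠ 0 := fun hc => ha (by rw [hc, zero_smul])
  exact Submodule.mem_span_singleton.2 ⟨c⁻¹, by rw [smul_smul, inv_mul_cancel₀ hc, one_smul]⟩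

/-- Provides an affine line a + Fb of non-singular radical vectors. If a first choice of b yields a
singular a + cb, that vector replaces b: Q is additive on the radical, so Q is then constant on the
line. -/
theorem exists_mem_rad_notMem_span {Q : QuadraticForm F V}
    (hrad : 2 ≤ Module.finrank F (rad Q)) {a : V} (ha : a ∈ rad Q) (hQa : Q a ≠ 0) :
    ∃ b ∈ rad Q, a ∉ Submodule.span F {b} ∧ b ≠ 0 ∧ ∀ c : F, Q (a + c • b) ≠ 0 := by
  have ha0 : a ≠ 0 := fun h => hQa (by rw [h, QuadraticMap.map_zero])
  obtain ⟨b, hb, hab⟩ := exists_mem_notMem_span hrad a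
  by_cases h : ∀ c : F, Q (a + c • b) ≠ 0
  · exact ⟨b, hb, (notMem_span_singleton_symm ha0 hab).1, (notMem_span_singleton_symm ha0 hab).2, h⟩
  push Not at h
  obtain ⟨c, hc⟩ := h
  have hc0 : c ≠ 0 := fun h0 => hQa (by rwa [h0, zero_smul, add_zero] at hc)
  have hspan : a + c • b ∉ Submodule.span F {a} := fun hmem => hab <| by
    rwa [Submodule.add_mem_iff_right _ (Submodule.mem_span_singleton_self a),
      Submodule.smul_mem_iff _ hc0] at hmem
  refine ⟨a + c • b, add_mem ha (Submodule.smul_mem _ _ hb),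
    (notMem_span_singleton_symm ha0 hspan).1, (notMem_span_singleton_symm ha0 hspan).2, fun r => ?_⟩
  rwa [QuadraticMap.map_add Q, mem_rad.1 ha, QuadraticMap.map_smul, hc, smul_zero, add_zero,
    add_zero]

/-! ### The kernel and the images of the even points -/

theorem theta_surjective [FiniteDimensional F V] (Q : QuadraticForm F V) :
    Function.Surjective (theta Q) := by
  intro y
  obtain ⟨φ, rfl⟩ := QuotientGroup.mk_surjective y
  obtain ⟨p, rfl⟩ := xi_surjective Q φ
  exact ⟨lipPoint Q p, theta_lipPoint Q p⟩

theorem lift_mk_le_ker_even_of_singular {Q : QuadraticForm F V}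
    (hrad : 2 ≤ Module.finrank F (rad Q)) (hQ : ∀ x ∈ rad Q, Q x = 0) :
    Cardinal.lift.{v} (Cardinal.mk F) ≤
      Cardinal.mk (((theta Q).ker : Set (ptGroup Q)) ∩ ptPart Q 0 : Set (ptGroup Q)) := by
  obtain ⟨t, ht, ht0⟩ := exists_mem_notMem_span hrad 0
  replace ht0 : t ≠ 0 := fun h => ht0 (by rw [h]; exact zero_mem _)
  obtain ⟨s, hs, hst⟩ := exists_mem_notMem_span hrad t
  have hcs : ∀ c : F, c • s ∈ rad Q := fun c => Submodule.smul_mem _ _ hs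
  refine lift_mk_le_of_injective (fun c => lipPoint Q (siegelLip Q (c • s) t (hQ _ (hcs c)) (hQ t ht)
    (mem_rad.1 (hcs c) t))) (fun c d h => ?_) (fun c => ⟨?_, ?_⟩)
  · obtain ⟨k, hk⟩ := exists_smul_of_lipPoint_eq h
    rw [coe_siegelLip, coe_siegelLip, map_smul, map_smul, smul_mul_assoc, smul_mul_assoc,
      ← map_one (algebraMap F (CliffordAlgebra Q))] at hk
    exact coeff_eq_of_smul_eq hst ht0 one_ne_zero hk
  · exact lipPoint_mem_ker_of_xi_eq_one (xi_siegelLip_eq_one (hcs c) ht _ _ _)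
  · rw [lipPoint_mem_ptPart, coe_siegelLip]
    exact add_mem (Submodule.one_le.1 (one_le_evenOdd_zero Q)) (ι_mul_ι_mem_evenOdd_zero Q _ _)

theorem ker_inter_odd_eq_empty [FiniteDimensional F V] {Q : QuadraticForm F V} (hbot : rad Q ≠ ⊥)
    (hQ : ∀ x ∈ rad Q, Q x = 0) : ((theta Q).ker : Set (ptGroup Q)) ∩ ptPart Q 1 = ∅ := by
  refine Set.eq_empty_of_forall_notMem ?_
  rintro X ⟨hX, hX1⟩
  obtain ⟨p, rfl⟩ := lipPoint_surjective Q X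
  exact xi_eq_one_not_odd hQ (xi_eq_one_of_mem_ker hbot hX) (lipPoint_mem_ptPart.1 hX1)

theorem ptPart_zero_eq_univ [FiniteDimensional F V] {Q : QuadraticForm F V}
    (hQ : ∀ x ∈ rad Q, Q x = 0) (htop : rad Q = ⊤) : ptPart Q 0 = Set.univ := by
  refine Set.eq_univ_of_forall fun X => ?_
  obtain ⟨p, rfl⟩ := lipPoint_surjective Q X
  rw [lipPoint_mem_ptPart]
  have h1 : xi Q p = 1 := Subtype.ext <| LinearEquiv.ext fun x =>
    (xi Q p).2.2 x (htop ▸ Submodule.mem_top)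
  exact (even_or_odd_of_mem_lipMonoid p.2).resolve_right (xi_eq_one_not_odd hQ h1)

/-- An even point with the same image as a reflection, which comes from an odd vector, would differ
from it by an odd point of the kernel. -/
theorem theta_image_even_ne_univ [FiniteDimensional F V] {Q : QuadraticForm F V}
    (hbot : rad Q ≠ ⊥) (hQ : ∀ x ∈ rad Q, Q x = 0) (htop : rad Q ≠ ⊤) :
    theta Q '' ptPart Q 0 ≠ Set.univ := by
  intro himage
  obtain ⟨a, ha⟩ : ∃ a, Q a ≠ 0 := by
    by_contra! h
    refine htop (eq_top_iff.2 fun x _ => mem_rad.2 fun y => ?_)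
    rw [QuadraticMap.polar, h, h, h, sub_zero, sub_zero]
  obtain ⟨X, hX, hXa⟩ : theta Q (lipPoint Q (vecLip Q a ha)) ∈ theta Q '' ptPart Q 0 :=
    himage ▸ Set.mem_univ _
  obtain ⟨p, rfl⟩ := lipPoint_surjective Q X
  have hker : lipPoint Q ((vecLip Q a ha)⁻¹ * p) ∈ (theta Q).ker := by
    rw [MonoidHom.mem_ker, map_mul, map_inv, map_mul, map_inv, hXa, inv_mul_cancel]
  refine Set.eq_empty_iff_forall_notMem.1 (ker_inter_odd_eq_empty hbot hQ) _
    ⟨hker, lipPoint_mem_ptPart.2 ?_⟩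
  have hinv : (↑(vecLip Q a ha).1⁻¹ : CliffordAlgebra Q) ∈ evenOdd Q 1 := by
    change algebraMap F (CliffordAlgebra Q) (Q a)⁻¹ * ι Q a ∈ evenOdd Q 1
    rw [← Algebra.smul_def]
    exact Submodule.smul_mem _ _ (ι_mem_evenOdd_one Q a)
  exact evenOdd_mul_le Q 1 0 (Submodule.mul_mem_mul hinv (lipPoint_mem_ptPart.1 hX))

theorem lift_mk_le_ker_odd {Q : QuadraticForm F V} (hrad : 2 ≤ Module.finrank F (rad Q)) {a : V}
    (ha : a ∈ rad Q) (hQa : Q a ≠ 0) :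
    Cardinal.lift.{v} (Cardinal.mk F) ≤
      Cardinal.mk (((theta Q).ker : Set (ptGroup Q)) ∩ ptPart Q 1 : Set (ptGroup Q)) := by
  obtain ⟨b, hb, hab, hb0, hQ⟩ := exists_mem_rad_notMem_span hrad ha hQa
  refine lift_mk_le_of_injective (fun c => lipPoint Q (vecLip Q (a + c • b) (hQ c)))
    (fun c d h => ?_) (fun c => ⟨?_, ?_⟩)
  · obtain ⟨k, hk⟩ := exists_smul_of_lipPoint_eq h
    rw [coe_vecLip, coe_vecLip, ← map_smul] at hk
    replace hk := ι_inj Q hk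
    have h1 : (k - 1) • a = (d - k * c) • b := by
      rw [sub_smul, sub_smul, one_smul, mul_smul, sub_eq_sub_iff_add_eq_add, ← smul_add, hk,
        add_comm]
    have h2 : k = 1 := by
      by_contra hk1
      refine hab (Submodule.mem_span_singleton.2 ⟨(k - 1)⁻¹ * (d - k * c), ?_⟩)
      rw [mul_smul, ← h1, smul_smul, inv_mul_cancel₀ (sub_ne_zero.2 hk1), one_smul]
    rw [h2, sub_self, zero_smul, one_mul] at h1
    exact (sub_eq_zero.1 ((smul_eq_zero.1 h1.symm).resolve_right hb0)).symm
  · exact lipPoint_mem_ker_of_xi_eq_one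
      (xi_vecLip_eq_one (add_mem ha (Submodule.smul_mem _ _ hb)) _)
  · exact lipPoint_mem_ptPart.2 (ι_mem_evenOdd_one Q _)

/-- The products a(a + cb) = Q(a) + c ab have a fixed non-zero scalar part, so c is determined by
the point. -/
theorem lift_mk_le_ker_even_of_nonsingular {Q : QuadraticForm F V}
    (hrad : 2 ≤ Module.finrank F (rad Q)) {a : V} (ha : a ∈ rad Q) (hQa : Q a ≠ 0) :
    Cardinal.lift.{v} (Cardinal.mk F) ≤
      Cardinal.mk (((theta Q).ker : Set (ptGroup Q)) ∩ ptPart Q 0 : Set (ptGroup Q)) := by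
  obtain ⟨b, hb, hab, hb0, hQ⟩ := exists_mem_rad_notMem_span hrad ha hQa
  have hcoe : ∀ c : F, ((vecLip Q a hQa * vecLip Q (a + c • b) (hQ c)).1 : CliffordAlgebra Q) =
      algebraMap F (CliffordAlgebra Q) (Q a) + c • (ι Q a * ι Q b) := fun c => by
    change ι Q a * ι Q (a + c • b) = _
    rw [map_add, map_smul, mul_add, ι_sq_scalar, mul_smul_comm]
  refine lift_mk_le_of_injective (fun c => lipPoint Q (vecLip Q a hQa * vecLip Q (a + c • b) (hQ c)))
    (fun c d h => ?_) (fun c => ⟨?_, ?_⟩)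
  · obtain ⟨k, hk⟩ := exists_smul_of_lipPoint_eq h
    rw [hcoe, hcoe] at hk
    exact coeff_eq_of_smul_eq hab hb0 hQa hk
  · refine lipPoint_mem_ker_of_xi_eq_one ?_
    rw [map_mul, xi_vecLip_eq_one ha, xi_vecLip_eq_one (add_mem ha (Submodule.smul_mem _ _ hb)),
      one_mul]
  · exact lipPoint_mem_ptPart.2 (ι_mul_ι_mem_evenOdd_zero Q _ _)

theorem theta_image_even_eq_univ [FiniteDimensional F V] {Q : QuadraticForm F V} {a : V}
    (ha : a ∈ rad Q) (hQa : Q a ≠ 0) : theta Q '' ptPart Q 0 = Set.univ := by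
  refine Set.eq_univ_of_forall fun y => ?_
  obtain ⟨X, rfl⟩ := theta_surjective Q y
  obtain ⟨p, rfl⟩ := lipPoint_surjective Q X
  rcases even_or_odd_of_mem_lipMonoid p.2 with hp | hp
  · exact ⟨_, lipPoint_mem_ptPart.2 hp, rfl⟩
  -- Multiplication by the radical vector a makes p even without changing ξ_p.
  · refine ⟨lipPoint Q (vecLip Q a hQa * p), lipPoint_mem_ptPart.2 ?_, ?_⟩
    · exact evenOdd_mul_le Q 1 1 (Submodule.mul_mem_mul (ι_mem_evenOdd_one Q a) hp)
    · rw [theta_lipPoint, theta_lipPoint, map_mul, xi_vecLip_eq_one ha, one_mul]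

end

end ProjMetric

theorem theorem5p3 {F : Type u} {V : Type v} [Field F] [AddCommGroup V] [Module F V]
    [FiniteDimensional F V] (Q : QuadraticForm F V)
    (hrad : 2 ≤ Module.finrank F (ProjMetric.rad Q)) :
    Function.Surjective (ProjMetric.theta Q) ∧
    ((∀ x ∈ ProjMetric.rad Q, Q x = 0) →
      Cardinal.lift.{v} (Cardinal.mk F) ≤ Cardinal.mk
        (((ProjMetric.theta Q).ker : Set (ProjMetric.ptGroup Q)) ∩ ProjMetric.ptPart Q 0 :
          Set (ProjMetric.ptGroup Q)) ∧
      ((ProjMetric.theta Q).ker : Set (ProjMetric.ptGroup Q)) ∩ ProjMetric.ptPart Q 1 = ∅) ∧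
    ((∀ x ∈ ProjMetric.rad Q, Q x = 0) →
      Module.finrank F V = Module.finrank F (ProjMetric.rad Q) →
      ProjMetric.ptPart Q 0 = Set.univ) ∧
    ((∀ x ∈ ProjMetric.rad Q, Q x = 0) →
      Module.finrank F (ProjMetric.rad Q) < Module.finrank F V →
      ProjMetric.theta Q '' ProjMetric.ptPart Q 0 ≠ Set.univ) ∧
    ((¬ ∀ x ∈ ProjMetric.rad Q, Q x = 0) →
      Cardinal.lift.{v} (Cardinal.mk F) ≤ Cardinal.mk
        (((ProjMetric.theta Q).ker : Set (ProjMetric.ptGroup Q)) ∩ ProjMetric.ptPart Q 0 :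
          Set (ProjMetric.ptGroup Q)) ∧
      Cardinal.lift.{v} (Cardinal.mk F) ≤ Cardinal.mk
        (((ProjMetric.theta Q).ker : Set (ProjMetric.ptGroup Q)) ∩ ProjMetric.ptPart Q 1 :
          Set (ProjMetric.ptGroup Q)) ∧
      ProjMetric.theta Q '' ProjMetric.ptPart Q 0 = Set.univ) := by
  have hbot : ProjMetric.rad Q ≠ ⊥ := fun h => by
    rw [h, finrank_bot] at hrad
    omega
  refine ⟨ProjMetric.theta_surjective Q, fun hQ =>
    ⟨ProjMetric.lift_mk_le_ker_even_of_singular hrad hQ,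
      ProjMetric.ker_inter_odd_eq_empty hbot hQ⟩,
    fun hQ hdim => ProjMetric.ptPart_zero_eq_univ hQ (Submodule.eq_top_of_finrank_eq hdim.symm),
    fun hQ hdim => ProjMetric.theta_image_even_ne_univ hbot hQ fun h => ?_, fun hQ => ?_⟩
  · rw [h, finrank_top] at hdim
    exact lt_irrefl _ hdim
  · push Not at hQ
    obtain ⟨a, ha, hQa⟩ := hQ
    exact ⟨ProjMetric.lift_mk_le_ker_even_of_nonsingular hrad ha hQa,
      ProjMetric.lift_mk_le_ker_odd hrad ha hQa, ProjMetric.theta_image_even_eq_univ ha hQa⟩
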